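/- Let $\mathfrak g$ be a finite-dimensional real semisimple Lie algebra with Killing form $B$ (in the paper, the Lie algebra of a noncompact connected semisimple Lie group $G$ with finite centre), let $\theta$ be a Cartan involution of $\mathfrak g$ with Cartan decomposition $\mathfrak g=\mathfrak k\oplus\mathfrak p$, and let $\mathfrak a$ be a maximal abelian subspace of $\mathfrak p$, $l=\dim\mathfrak a$. Identify $\mathfrak a$ and $\mathfrak a^*$ with $\mathbb R^l$ as inner product spaces, the inner product on $\mathfrak a$ being $B|_{\mathfrak a\times\mathfrak a}$, and let $|\cdot|$ be the norm. Let $W$ be the Weyl group of $(\mathfrak g,\mathfrak a)$, that is, the group of transformations of $\mathfrak a$ induced by those elements of $\mathrm{Ad}(K)=\langle \exp(\mathrm{ad}\,X): X\in\mathfrak k\rangle$ that preserve $\mathfrak a$; it is a finite subgroup of $O(l)$. Fix a system $\Sigma^+$ of positive restricted roots and let $\rho=\frac12\sum_{\alpha\in\Sigma^+}m_\alpha\,\alpha$, where $m_\alpha=\dim\mathfrak g_\alpha$. For $f\in S(\mathbb R^l)$ and $w\in W$ put $(wf)(x)=f(wx)$. Let $S(\mathbb R^l)_W$ be the space of those $f\in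 S(\mathbb R^l)$ with $wf=f$ for all $w\in W$, and call a tempered distribution $T$ on $\mathbb R^l$ $W$-invariant if $T(wf)=T(f)$ for all $w\in W$ and $f\in S(\mathbb R^l)$. Let $L$ be the Laplacian of $\mathbb R^l$ and $L_1=L-|\rho|^2$. **Theorem.** Let $\{T_j\}_{j\in\mathbb Z}$ be a doubly infinite sequence of $W$-invariant tempered distributions on $\mathbb R^l$ such that (i) there is $z\in\mathbb C$ with $|z|\ge|\rho|^2$ such that $L_1T_j=zT_{j+1}$ for all $j\in\mathbb Z$; (ii) there are a continuous seminorm $\mu$ on $S(\mathbb R^l)$ and $M>0$ such that $|\langle T_j,\psi\rangle|\le M\mu(\psi)$ for all $j\in\mathbb Z$ and all $\psi\in S(\mathbb R^l)_W$. Then $L_1T_0=-|z|\,T_0$. -/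

import Mathlib

open scoped SchwartzMap Laplacian

noncomputable section

namespace SymmetricSpaceData

variable {𝔤 : Type*} [LieRing 𝔤] [LieAlgebra ℝ 𝔤]

/-- `θ` is a Cartan involution of the real Lie algebra `𝔤` with Killing form `B`: it is an
involutive automorphism and `(X, Y) ↦ -B(X, θ Y)` is positive definite. -/
def IsCartanInvolution (θ : 𝔤 ≃ₗ⁅ℝ⁆ 𝔤) : Prop :=
  (∀ X, θ (θ X) = X) ∧ ∀ X, X ≠ 0 → 0 < -killingForm ℝ 𝔤 X (θ X)

/-- `𝔞` is a maximal abelian subspace of `𝔭 = {X | θ X = -X}`. -/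
def IsMaximalAbelianIn (θ : 𝔤 ≃ₗ⁅ℝ⁆ 𝔤) (𝔞 : Submodule ℝ 𝔤) : Prop :=
  (∀ X ∈ 𝔞, θ X = -X) ∧ (∀ X ∈ 𝔞, ∀ Y ∈ 𝔞, ⁅X, Y⁆ = 0) ∧
    ∀ X, θ X = -X → (∀ Y ∈ 𝔞, ⁅X, Y⁆ = 0) → X ∈ 𝔞

/-- The root space `𝔤_α = {X | ⁅H, X⁆ = α(H) X for all H ∈ 𝔞}`. -/
def rootSpace (𝔞 : Submodule ℝ 𝔤) (α : Module.Dual ℝ 𝔞) : Submodule ℝ 𝔤 :=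
  ⨅ H : 𝔞, Module.End.eigenspace (LieAlgebra.ad ℝ 𝔤 (H : 𝔤)) (α H)

theorem mem_rootSpace (𝔞 : Submodule ℝ 𝔤) (α : Module.Dual ℝ 𝔞) (X : 𝔤) :
    X ∈ rootSpace 𝔞 α ↔ ∀ H : 𝔞, ⁅(H : 𝔤), X⁆ = α H • X := by
  simp [rootSpace]

/-- The set `Σ` of restricted roots of the pair `(𝔤, 𝔞)`. -/
def restrictedRoots (𝔞 : Submodule ℝ 𝔤) : Set (Module.Dual ℝ 𝔞) :=
  {α | α ≠ 0 ∧ rootSpace 𝔞 α ≠ ⊥}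

/-- `H₀ ∈ 𝔞` is regular: no restricted root vanishes at it. -/
def IsRegular (𝔞 : Submodule ℝ 𝔤) (H₀ : 𝔞) : Prop :=
  ∀ α ∈ restrictedRoots 𝔞, α H₀ ≠ 0

/-- The system `Σ⁺` of positive restricted roots given by the Weyl chamber of the
regular element `H₀`. -/
def positiveRoots (𝔞 : Submodule ℝ 𝔤) (H₀ : 𝔞) : Set (Module.Dual ℝ 𝔞) :=
  {α | α ∈ restrictedRoots 𝔞 ∧ 0 < α H₀}

/-- There are finitely many positive restricted roots (so that the sum in `rho` is a genuine
finite sum). -/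
theorem positiveRoots_finite [FiniteDimensional ℝ 𝔤] (𝔞 : Submodule ℝ 𝔤)
    (h𝔞 : ∀ X ∈ 𝔞, ∀ Y ∈ 𝔞, ⁅X, Y⁆ = 0) (H₀ : 𝔞) : (positiveRoots 𝔞 H₀).Finite := by
  have hcomm : ∀ H H' : 𝔞, Commute (LieAlgebra.ad ℝ 𝔤 (H : 𝔤)) (LieAlgebra.ad ℝ 𝔤 (H' : 𝔤)) := by
    intro H H'
    refine LinearMap.ext fun X => ?_
    have h := leibniz_lie (H : 𝔤) (H' : 𝔤) X
    rw [h𝔞 _ H.2 _ H'.2, zero_lie, zero_add] at h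
    simpa [Module.End.mul_apply] using h
  have hind := Module.End.independent_iInf_maxGenEigenspace_of_forall_mapsTo
    (fun H : 𝔞 => LieAlgebra.ad ℝ 𝔤 (H : 𝔤))
    (fun i j φ => Module.End.mapsTo_maxGenEigenspace_of_comm (hcomm j i) φ)
  have hfin := WellFoundedGT.finite_ne_bot_of_iSupIndep hind
  refine Set.Finite.of_finite_image (f := fun α : Module.Dual ℝ 𝔞 => (α : 𝔞 → ℝ))
    (hfin.subset ?_) DFunLike.coe_injective.injOn
  rintro _ ⟨α, ⟨⟨-, hα⟩, -⟩, rfl⟩ hbot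
  refine hα (eq_bot_iff.mpr (le_trans ?_ hbot.le))
  exact iInf_mono fun H => (Module.End.genEigenspace _ _).monotone le_top

/-- `ρ ∈ 𝔞*`, the half-sum of the positive restricted roots counted with their
multiplicities `m_α = dim 𝔤_α`. -/
def rho (𝔞 : Submodule ℝ 𝔤) (H₀ : 𝔞) : Module.Dual ℝ 𝔞 :=
  (1 / 2 : ℝ) • ∑ᶠ α ∈ positiveRoots 𝔞 H₀, (Module.finrank ℝ (rootSpace 𝔞 α) : ℝ) • α

/-- The automorphism `φ` of `𝔤` is `exp (ad X)`; the exponential series converges pointwise in the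
finite-dimensional space `𝔤`, which is expressed by applying all linear functionals. -/
def IsExpAd (X : 𝔤) (φ : 𝔤 ≃ₗ⁅ℝ⁆ 𝔤) : Prop :=
  ∀ (Y : 𝔤) (f : Module.Dual ℝ 𝔤),
    HasSum (fun n : ℕ => ((n.factorial : ℝ)⁻¹) * f (((LieAlgebra.ad ℝ 𝔤 X) ^ n) Y)) (f (φ Y))

/-- The group `Ad(K)`, for the (connected) maximal compact subgroup `K` with Lie algebra
`𝔨 = {X | θ X = X}`: the group generated by the automorphisms `exp (ad X)`, `X ∈ 𝔨`. -/
def adK (θ : 𝔤 ≃ₗ⁅ℝ⁆ 𝔤) : Subgroup (𝔤 ≃ₗ[ℝ] 𝔤) :=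
  Subgroup.closure {g | ∃ (X : 𝔤) (φ : 𝔤 ≃ₗ⁅ℝ⁆ 𝔤), θ X = X ∧ IsExpAd X φ ∧ g = φ.toLinearEquiv}

/-- `e` identifies `ℝˡ`, as an inner product space, with `𝔞` carrying the Killing form. -/
def IsKillingIsometry {l : ℕ} {𝔞 : Submodule ℝ 𝔤} (e : EuclideanSpace ℝ (Fin l) ≃ₗ[ℝ] 𝔞) : Prop :=
  ∀ x y, killingForm ℝ 𝔤 (e x : 𝔤) (e y : 𝔤) = inner ℝ x y

/-- The Weyl group `W = N_K(𝔞) / Z_K(𝔞)`, realised as the group of the transformations which the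
elements of `Ad(K)` preserving `𝔞` induce on `𝔞`, which is identified with `ℝˡ` by `e`.
Since `Ad(K)` preserves the Killing form, these transformations lie in `O(l)`. -/
def weylGroup (θ : 𝔤 ≃ₗ⁅ℝ⁆ 𝔤) {l : ℕ} {𝔞 : Submodule ℝ 𝔤}
    (e : EuclideanSpace ℝ (Fin l) ≃ₗ[ℝ] 𝔞) :
    Subgroup (EuclideanSpace ℝ (Fin l) ≃ₗᵢ[ℝ] EuclideanSpace ℝ (Fin l)) where
  carrier := {w | ∃ k ∈ adK θ, ∀ x, k (e x : 𝔤) = (e (w x) : 𝔤)}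
  one_mem' := ⟨1, one_mem _, fun _ => rfl⟩
  mul_mem' := by
    rintro v w ⟨k, hk, hv⟩ ⟨k', hk', hw⟩
    refine ⟨k * k', mul_mem hk hk', fun x => ?_⟩
    rw [LinearEquiv.mul_apply, hw, hv]
    rfl
  inv_mem' := by
    rintro w ⟨k, hk, hw⟩
    refine ⟨k⁻¹, inv_mem hk, fun x => ?_⟩
    apply k.injective
    rw [hw]
    have h : w (w⁻¹ x) = x := w.apply_symm_apply x
    rw [h]
    exact k.apply_symm_apply (e x : 𝔤)

/-- The vector of `ℝˡ` that corresponds to `ρ ∈ 𝔞*` under the identifications of `𝔞` and `𝔞*` with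
`ℝˡ` through the Killing form: `⟨rhoVec, x⟩ = ρ(e x)`. -/
def rhoVec {l : ℕ} {𝔞 : Submodule ℝ 𝔤} (e : EuclideanSpace ℝ (Fin l) ≃ₗ[ℝ] 𝔞) (H₀ : 𝔞) :
    EuclideanSpace ℝ (Fin l) :=
  (InnerProductSpace.toDual ℝ (EuclideanSpace ℝ (Fin l))).symm
    (LinearMap.toContinuousLinearMap (rho 𝔞 H₀ ∘ₗ e.toLinearMap))

end SymmetricSpaceData

namespace TemperedInvariance

variable {l : ℕ}

/-- The action `(w f)(x) = f(w x)` on Schwartz functions. -/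
def act (w : EuclideanSpace ℝ (Fin l) ≃ₗᵢ[ℝ] EuclideanSpace ℝ (Fin l)) :
    𝓢(EuclideanSpace ℝ (Fin l), ℂ) →L[ℂ] 𝓢(EuclideanSpace ℝ (Fin l), ℂ) :=
  SchwartzMap.compCLMOfContinuousLinearEquiv ℂ w.toContinuousLinearEquiv

/-- `f` belongs to the space `S(ℝˡ)_W` of `W`-invariant Schwartz functions. -/
def IsInvariantFun (W : Subgroup (EuclideanSpace ℝ (Fin l) ≃ₗᵢ[ℝ] EuclideanSpace ℝ (Fin l)))
    (f : 𝓢(EuclideanSpace ℝ (Fin l), ℂ)) : Prop :=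
  ∀ w ∈ W, ∀ x, f (w x) = f x

/-- `T` is a `W`-invariant tempered distribution: `w T = T` for all `w ∈ W`, where
`(w T) f = T (w f)`. -/
def IsInvariantDist (W : Subgroup (EuclideanSpace ℝ (Fin l) ≃ₗᵢ[ℝ] EuclideanSpace ℝ (Fin l)))
    (T : 𝓢'(EuclideanSpace ℝ (Fin l), ℂ)) : Prop :=
  ∀ w ∈ W, ∀ f, T (act w f) = T f

/-- The operator `L - |ρ|²` on tempered distributions, `L` being the Laplacian of `ℝˡ`. -/
def shiftedLaplacian (ρ : EuclideanSpace ℝ (Fin l)) (T : 𝓢'(EuclideanSpace ℝ (Fin l), ℂ)) :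
    𝓢'(EuclideanSpace ℝ (Fin l), ℂ) :=
  Δ T - ((‖ρ‖ ^ 2 : ℝ) : ℂ) • T

end TemperedInvariance

end

/-! ### Finiteness of the Weyl group. -/

namespace SymmetricSpaceData

variable {𝔤 : Type*} [LieRing 𝔤] [LieAlgebra ℝ 𝔤]

/-! The Weyl group `W` is finite because it acts faithfully on the finite set of weights of `𝔞`.
Averaging over `W` then turns the bound on invariant test functions into a bound of all `T j` by one
continuous seminorm on the whole Schwartz space, and the rest needs no symmetry.

On the Fourier side `L - |ρ|²` is multiplication by `-(4π²|x|² + |ρ|²)`. For `z ≠ 0`, put `b =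
(4π²|x|² + |ρ|²) / |z|` and `u = -z / |z|`. The distributions `S k = u ^ k • T k`, transported by
Fourier, satisfy `b S k = S (k + 1)` and are uniformly bounded; the claim becomes `S 1 = S 0`.

Heuristically, `b ^ k S 0` blows up as `k → ∞` where `b > 1` and as `k → -∞` where `b < 1`, so `S 0`
lives on `b = 1`. To make this precise, both directions are used at once: `t ^ j / (1 + t ^ (2 *
j))` is small off `t = 1`, while applying `S k` to a multiple of `(1 + b ^ (2 * j)) ^ p` costs only
a factor `2 ^ p`. With enough factors `t - 1`, all derivatives seen by the seminorm are `O(1 / j)`,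
which gives `(b - 1) ^ (m + 1) S k = 0` (`SchwartzMap.eq_of_bounded_of_smulLeftCLM_shift`). Hence `S
k` is polynomial in `k`, and being bounded it is constant (`apply_sub_one_eq_zero_of_bounded`). -/

theorem IsCartanInvolution.killingForm_apply_left {θ : 𝔤 ≃ₗ⁅ℝ⁆ 𝔤} (hθ : IsCartanInvolution θ)
    (X Y : 𝔤) : killingForm ℝ 𝔤 (θ X) Y = killingForm ℝ 𝔤 X (θ Y) := by
  rw [← LieAlgebra.killingForm_of_equiv_apply θ (θ X) Y, hθ.1]

/-- The inner product `(X, Y) ↦ -B(X, θ Y)` of a Cartan involution `θ`. -/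
@[reducible]
noncomputable def IsCartanInvolution.innerCore {θ : 𝔤 ≃ₗ⁅ℝ⁆ 𝔤} (hθ : IsCartanInvolution θ) :
    InnerProductSpace.Core ℝ 𝔤 where
  inner X Y := -killingForm ℝ 𝔤 X (θ Y)
  conj_inner_symm X Y := by
    simp only [conj_trivial, neg_inj]
    rw [← hθ.killingForm_apply_left, LieModule.traceForm_comm]
  re_inner_nonneg X := by
    by_cases h : X = 0
    · simp [h]
    · exact (hθ.2 X h).le
  add_left X Y Z := by simp; ring
  smul_left X Y r := by simp
  definite X h := by
    by_contra hX
    exact (hθ.2 X hX).ne' h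

theorem commute_ad {𝔞 : Submodule ℝ 𝔤} (h𝔞 : ∀ X ∈ 𝔞, ∀ Y ∈ 𝔞, ⁅X, Y⁆ = 0) (H H' : 𝔞) :
    Commute (LieAlgebra.ad ℝ 𝔤 (H : 𝔤)) (LieAlgebra.ad ℝ 𝔤 (H' : 𝔤)) := by
  refine LinearMap.ext fun X => ?_
  have h := leibniz_lie (H : 𝔤) (H' : 𝔤) X
  rw [h𝔞 _ H.2 _ H'.2, zero_lie, zero_add] at h
  simpa [Module.End.mul_apply] using h

/-- The joint eigenspaces of `ad H`, `H ∈ 𝔞`, span `𝔤`. -/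
theorem IsCartanInvolution.iSup_iInf_eigenspace_eq_top [FiniteDimensional ℝ 𝔤] {θ : 𝔤 ≃ₗ⁅ℝ⁆ 𝔤}
    (hθ : IsCartanInvolution θ) {𝔞 : Submodule ℝ 𝔤} (h𝔞 : IsMaximalAbelianIn θ 𝔞) :
    ⨆ χ : 𝔞 → ℝ, ⨅ H : 𝔞, Module.End.eigenspace (LieAlgebra.ad ℝ 𝔤 (H : 𝔤)) (χ H) = ⊤ := by
  -- For the inner product `-B(X, θ Y)` each `ad H` is symmetric, since `θ H = -H`; commuting
  -- symmetric operators are jointly diagonalisable.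
  let : NormedAddCommGroup 𝔤 := hθ.innerCore.toNormedAddCommGroup
  let : InnerProductSpace ℝ 𝔤 := InnerProductSpace.ofCore hθ.innerCore.toCore
  refine LinearMap.IsSymmetric.iSup_iInf_eq_top_of_commute (𝕜 := ℝ) (E := 𝔤)
    (T := fun H : 𝔞 => LieAlgebra.ad ℝ 𝔤 (H : 𝔤)) (fun H X Y => ?_)
    (fun H H' _ => commute_ad h𝔞.2.1 H H')
  change -killingForm ℝ 𝔤 ⁅(H : 𝔤), X⁆ (θ Y) = -killingForm ℝ 𝔤 X (θ ⁅(H : 𝔤), Y⁆)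
  rw [LieEquiv.map_lie, h𝔞.1 _ H.2, killingForm, LieModule.traceForm_apply_lie_apply', neg_lie,
    map_neg]

theorem finite_setOf_rootSpace_ne_bot [FiniteDimensional ℝ 𝔤] {𝔞 : Submodule ℝ 𝔤}
    (h𝔞 : ∀ X ∈ 𝔞, ∀ Y ∈ 𝔞, ⁅X, Y⁆ = 0) :
    {α : Module.Dual ℝ 𝔞 | rootSpace 𝔞 α ≠ ⊥}.Finite := by
  have hind := Module.End.independent_iInf_maxGenEigenspace_of_forall_mapsTo
    (fun H : 𝔞 => LieAlgebra.ad ℝ 𝔤 (H : 𝔤))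
    (fun i j φ => Module.End.mapsTo_maxGenEigenspace_of_comm (commute_ad h𝔞 j i) φ)
  have hfin := WellFoundedGT.finite_ne_bot_of_iSupIndep hind
  refine Set.Finite.of_finite_image (f := fun α : Module.Dual ℝ 𝔞 => (α : 𝔞 → ℝ))
    (hfin.subset ?_) DFunLike.coe_injective.injOn
  rintro _ ⟨α, hα, rfl⟩ hbot
  refine hα (eq_bot_iff.mpr (le_trans ?_ hbot.le))
  exact iInf_mono fun H => (Module.End.genEigenspace _ _).monotone le_top

/-- An element of `𝔞` at which all weights of `𝔞` in `𝔤` vanish is central. -/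
theorem IsCartanInvolution.ad_eq_zero_of_forall_weight [FiniteDimensional ℝ 𝔤] {θ : 𝔤 ≃ₗ⁅ℝ⁆ 𝔤}
    (hθ : IsCartanInvolution θ) {𝔞 : Submodule ℝ 𝔤} (h𝔞 : IsMaximalAbelianIn θ 𝔞) (H : 𝔞)
    (hH : ∀ α : Module.Dual ℝ 𝔞, rootSpace 𝔞 α ≠ ⊥ → α H = 0) :
    LieAlgebra.ad ℝ 𝔤 (H : 𝔤) = 0 := by
  rw [← LinearMap.ker_eq_top, ← top_le_iff, ← hθ.iSup_iInf_eigenspace_eq_top h𝔞]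
  refine iSup_le fun χ X hX => ?_
  simp only [Submodule.mem_iInf, Module.End.mem_eigenspace_iff, LieAlgebra.ad_apply] at hX
  by_cases hX0 : X = 0
  · simp [hX0]
  have hinj : Function.Injective fun c : ℝ => c • X := smul_left_injective ℝ hX0
  -- A joint eigenvector `X ≠ 0` forces its eigenvalue function `χ` to be linear.
  let α : Module.Dual ℝ 𝔞 :=
    { toFun := χ
      map_add' := fun x y => hinj <| by
        simp only
        rw [← hX, add_smul, ← hX, ← hX, Submodule.coe_add, add_lie]
      map_smul' := fun c x => hinj <| by
        simp only [RingHom.id_apply, smul_eq_mul]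
        rw [← hX, mul_smul, ← hX, Submodule.coe_smul, smul_lie] }
  have hα : α H = 0 := hH α fun hbot => hX0 <| by
    rw [← Submodule.mem_bot ℝ, ← hbot, mem_rootSpace]
    exact hX
  rw [LinearMap.mem_ker, LieAlgebra.ad_apply, hX, show χ H = 0 from hα, zero_smul]

theorem map_lie_of_mem_adK {θ : 𝔤 ≃ₗ⁅ℝ⁆ 𝔤} {k : 𝔤 ≃ₗ[ℝ] 𝔤} (hk : k ∈ adK θ) :
    ∀ X Y : 𝔤, k ⁅X, Y⁆ = ⁅k X, k Y⁆ := by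
  induction hk using Subgroup.closure_induction with
  | mem g hg =>
    obtain ⟨_, φ, _, _, rfl⟩ := hg
    exact fun X Y => φ.map_lie X Y
  | one => exact fun _ _ => rfl
  | mul g h _ _ hg hh => exact fun X Y => by simp only [LinearEquiv.mul_apply, hh, hg]
  | inv g _ hg =>
    intro X Y
    apply g.injective
    rw [hg]
    have h (Z : 𝔤) : g (g⁻¹ Z) = Z := g.apply_symm_apply Z
    simp only [h]

/-- The weights of `𝔞` in `𝔤` are permuted by the Weyl group. -/
theorem rootSpace_comp_ne_bot {θ : 𝔤 ≃ₗ⁅ℝ⁆ 𝔤} {l : ℕ} {𝔞 : Submodule ℝ 𝔤}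
    {e : EuclideanSpace ℝ (Fin l) ≃ₗ[ℝ] 𝔞}
    {w : EuclideanSpace ℝ (Fin l) ≃ₗᵢ[ℝ] EuclideanSpace ℝ (Fin l)} (hw : w ∈ weylGroup θ e)
    {α : Module.Dual ℝ 𝔞} (hα : rootSpace 𝔞 α ≠ ⊥) :
    rootSpace 𝔞 (α ∘ₗ (e.symm.trans (w.toLinearEquiv.trans e)).toLinearMap) ≠ ⊥ := by
  obtain ⟨k, hk, hkw⟩ := hw
  obtain ⟨X, hX, hX0⟩ := (Submodule.ne_bot_iff _).mp hα
  rw [mem_rootSpace] at hX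
  -- If `X` has weight `α` and `k` induces `w`, then `k⁻¹ X` has weight `α ∘ w`.
  refine (Submodule.ne_bot_iff _).mpr ⟨k.symm X, ?_, by simpa using hX0⟩
  rw [mem_rootSpace]
  intro H
  apply k.injective
  rw [map_lie_of_mem_adK hk, k.apply_symm_apply, map_smul, k.apply_symm_apply]
  have h := hkw (e.symm H)
  rw [e.apply_symm_apply] at h
  rw [h, hX]
  rfl

/-- The Weyl group is finite. -/
theorem finite_weylGroup [FiniteDimensional ℝ 𝔤] {θ : 𝔤 ≃ₗ⁅ℝ⁆ 𝔤} (hθ : IsCartanInvolution θ)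
    {𝔞 : Submodule ℝ 𝔤} (h𝔞 : IsMaximalAbelianIn θ 𝔞) {l : ℕ}
    {e : EuclideanSpace ℝ (Fin l) ≃ₗ[ℝ] 𝔞} (he : IsKillingIsometry e) :
    Finite (weylGroup θ e) := by
  have := (finite_setOf_rootSpace_ne_bot h𝔞.2.1).to_subtype
  let Λ := {α : Module.Dual ℝ 𝔞 | rootSpace 𝔞 α ≠ ⊥}
  let F : weylGroup θ e → Λ → Λ := fun w α => ⟨_, rootSpace_comp_ne_bot w.2 α.2⟩
  refine Finite.of_injective F fun w w' hww' => ?_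
  apply Subtype.ext
  refine LinearIsometryEquiv.ext fun x => ?_
  have hα (α : Module.Dual ℝ 𝔞) (h : rootSpace 𝔞 α ≠ ⊥) : α (e (w.1 x - w'.1 x)) = 0 := by
    have h1 := congrArg (fun β : Λ => (β : Module.Dual ℝ 𝔞) (e x)) (congrFun hww' ⟨α, h⟩)
    have h2 : α (e (w.1 x)) = α (e (w'.1 x)) := by simpa [F] using h1
    rw [map_sub, map_sub, h2, sub_self]
  have h0 := hθ.ad_eq_zero_of_forall_weight h𝔞 _ hα
  -- The squared norm is a value of the Killing form, which vanishes on an element with `ad = 0`.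
  have h1 := he (w.1 x - w'.1 x) (w.1 x - w'.1 x)
  rw [killingForm_apply_apply, h0, LinearMap.zero_comp, map_zero, eq_comm, inner_self_eq_zero,
    sub_eq_zero] at h1
  exact h1

end SymmetricSpaceData

/-! ### Hyperbolic functions of `j * log t`. -/

/-- `t ^ j / (1 + t ^ (2 * j))`, that is, `1 / (2 * cosh (j * log t))` for `t > 0`. -/
noncomputable def powSech (j : ℕ) (t : ℝ) : ℝ := t ^ j / (1 + t ^ (2 * j))

/-- `(1 - t ^ (2 * j)) / (1 + t ^ (2 * j))`, that is, `-tanh (j * log t)` for `t > 0`. -/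
noncomputable def powTanh (j : ℕ) (t : ℝ) : ℝ := (1 - t ^ (2 * j)) / (1 + t ^ (2 * j))

theorem one_add_pow_two_mul_pos (j : ℕ) (t : ℝ) : 0 < 1 + t ^ (2 * j) := by
  rw [pow_mul]; positivity

theorem powSech_nonneg (j : ℕ) {t : ℝ} (ht : 0 ≤ t) : 0 ≤ powSech j t :=
  div_nonneg (pow_nonneg ht j) (one_add_pow_two_mul_pos j t).le

theorem powSech_le_one (j : ℕ) (t : ℝ) : powSech j t ≤ 1 := by
  rw [powSech, div_le_one (one_add_pow_two_mul_pos j t), mul_comm 2 j, pow_mul]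
  nlinarith [sq_nonneg (t ^ j - 1)]

theorem abs_powTanh_le_one (j : ℕ) (t : ℝ) : |powTanh j t| ≤ 1 := by
  have h := one_add_pow_two_mul_pos j t
  have h' : 0 ≤ t ^ (2 * j) := by rw [pow_mul]; positivity
  rw [powTanh, abs_div, abs_of_pos h, div_le_one h, abs_le]
  constructor <;> linarith

/-- Bernoulli's inequality, applied to `t` when `t ≥ 1` and to `t⁻¹` when `0 < t ≤ 1`. Each factor
`t - 1` paired with a `powSech` thus gains `1 / j`. -/
theorem mul_abs_sub_one_mul_powSech_le_one (j : ℕ) {t : ℝ} (ht : 0 ≤ t) :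
    j * |t - 1| * powSech j t ≤ 1 := by
  have h := one_add_pow_two_mul_pos j t
  have hs : (t ^ j) * (t ^ j) = t ^ (2 * j) := by rw [two_mul, pow_add]
  rw [powSech, ← mul_div_assoc, div_le_one h]
  rcases le_total 1 t with h1 | h1
  · have hb := one_add_mul_sub_le_pow (a := t) (by linarith) j
    rw [abs_of_nonneg (by linarith), ← hs]
    nlinarith [pow_nonneg ht j]
  · rw [abs_of_nonpos (by linarith)]
    have key : j * (1 - t) * t ^ j ≤ 1 := by
      rcases ht.eq_or_lt with rfl | ht0
      · rcases j.eq_zero_or_pos with rfl | hj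
        · simp
        · simp [hj.ne']
      have hb := one_add_mul_sub_le_pow (a := t⁻¹) (by have := inv_pos.2 ht0; linarith) j
      have h2 : (1 - t) ≤ t⁻¹ - 1 := by
        have : t * t⁻¹ = 1 := mul_inv_cancel₀ ht0.ne'
        nlinarith [inv_pos.2 ht0, (one_le_inv₀ ht0).2 h1]
      have h3 : (j : ℝ) * (1 - t) ≤ (t⁻¹) ^ j := by
        have := mul_le_mul_of_nonneg_left h2 (Nat.cast_nonneg (α := ℝ) j)
        linarith
      calc j * (1 - t) * t ^ j ≤ (t⁻¹) ^ j * t ^ j := by gcongr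
        _ = 1 := by rw [← mul_pow, inv_mul_cancel₀ ht0.ne', one_pow]
    have : 0 ≤ t ^ (2 * j) := pow_nonneg ht _
    linarith

/-- Only `t * D` stays a polynomial in `powSech` and `powTanh`; spare powers of `t` will supply the
factor `t`. -/
theorem exists_hasDerivAt_powSech_pow (j p : ℕ) (t : ℝ) :
    ∃ D, HasDerivAt (fun t => powSech j t ^ p) D t ∧
      t * D = p * (j * powSech j t ^ p * powTanh j t) := by
  have h := one_add_pow_two_mul_pos j t
  refine ⟨_, (((hasDerivAt_pow j t).div ((hasDerivAt_pow (2 * j) t).const_add 1) h.ne').pow p), ?_⟩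
  rcases p with _ | p
  · simp
  rcases j with _ | j
  · simp
  simp only [powSech, powTanh, Nat.add_sub_cancel, show 2 * (j + 1) - 1 = 2 * j + 1 by omega,
    pow_succ (t ^ (j + 1) / _)]
  generalize (t ^ (j + 1) / (1 + t ^ (2 * (j + 1)))) ^ p = q
  field_simp
  push_cast
  ring

theorem exists_hasDerivAt_powTanh_pow (j d : ℕ) (t : ℝ) :
    ∃ D, HasDerivAt (fun t => powTanh j t ^ d) D t ∧
      t * D = -4 * d * (j * powSech j t ^ 2 * powTanh j t ^ (d - 1)) := by
  have h := one_add_pow_two_mul_pos j t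
  refine ⟨_, ((((hasDerivAt_pow (2 * j) t).const_sub 1).div
    ((hasDerivAt_pow (2 * j) t).const_add 1) h.ne').pow d), ?_⟩
  rcases j with _ | j
  · simp
  simp only [powSech, powTanh, show 2 * (j + 1) - 1 = 2 * j + 1 by omega]
  generalize ((1 - t ^ (2 * (j + 1))) / (1 + t ^ (2 * (j + 1)))) ^ (d - 1) = q
  field_simp
  push_cast
  ring

/-! ### Families whose derivatives are `O(1 / j)`. -/

/-- The derivatives of order at most `k` of the functions `G j` are `O(1 / j)` on `[0, ∞)`, up to
polynomial growth. -/
def DerivsDecay : ℕ → (ℕ → ℝ → ℝ) → Prop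
  | 0, G => ∃ (C : ℝ) (K : ℕ), 0 ≤ C ∧ ∀ j, 1 ≤ j → ∀ t, 0 ≤ t → |G j t| ≤ C / j * (1 + t) ^ K
  | k + 1, G => DerivsDecay 0 G ∧
      ∃ G', (∀ j t, HasDerivAt (G j) (G' j t) t) ∧ DerivsDecay k G'

theorem derivsDecay_zero {G : ℕ → ℝ → ℝ} : DerivsDecay 0 G ↔ ∃ (C : ℝ) (K : ℕ), 0 ≤ C ∧
    ∀ j, 1 ≤ j → ∀ t, 0 ≤ t → |G j t| ≤ C / j * (1 + t) ^ K := by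
  rw [DerivsDecay]

theorem derivsDecay_succ {k : ℕ} {G : ℕ → ℝ → ℝ} : DerivsDecay (k + 1) G ↔ DerivsDecay 0 G ∧
    ∃ G', (∀ j t, HasDerivAt (G j) (G' j t) t) ∧ DerivsDecay k G' := by
  simp only [DerivsDecay]

theorem DerivsDecay.zero {k : ℕ} {G : ℕ → ℝ → ℝ} (h : DerivsDecay k G) : DerivsDecay 0 G := by
  cases k with
  | zero => exact h
  | succ k => exact (derivsDecay_succ.1 h).1

theorem DerivsDecay.add {k : ℕ} {G₁ G₂ : ℕ → ℝ → ℝ} (h₁ : DerivsDecay k G₁)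
    (h₂ : DerivsDecay k G₂) : DerivsDecay k (fun j t => G₁ j t + G₂ j t) := by
  have h0 {G₁ G₂ : ℕ → ℝ → ℝ} (h₁ : DerivsDecay 0 G₁) (h₂ : DerivsDecay 0 G₂) :
      DerivsDecay 0 (fun j t => G₁ j t + G₂ j t) := by
    obtain ⟨C₁, K₁, hC₁, h₁⟩ := derivsDecay_zero.1 h₁
    obtain ⟨C₂, K₂, hC₂, h₂⟩ := derivsDecay_zero.1 h₂
    refine derivsDecay_zero.2 ⟨C₁ + C₂, max K₁ K₂, add_nonneg hC₁ hC₂, fun j hj t ht => ?_⟩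
    have e₁ : (1 + t) ^ K₁ ≤ (1 + t) ^ max K₁ K₂ :=
      pow_le_pow_right₀ (by linarith) (le_max_left _ _)
    have e₂ : (1 + t) ^ K₂ ≤ (1 + t) ^ max K₁ K₂ :=
      pow_le_pow_right₀ (by linarith) (le_max_right _ _)
    calc |G₁ j t + G₂ j t| ≤ |G₁ j t| + |G₂ j t| := abs_add_le _ _
      _ ≤ C₁ / j * (1 + t) ^ K₁ + C₂ / j * (1 + t) ^ K₂ := add_le_add (h₁ j hj t ht) (h₂ j hj t ht)
      _ ≤ C₁ / j * (1 + t) ^ max K₁ K₂ + C₂ / j * (1 + t) ^ max K₁ K₂ := by gcongr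
      _ = _ := by ring
  induction k generalizing G₁ G₂ with
  | zero => exact h0 h₁ h₂
  | succ k ih =>
    obtain ⟨a₁, G₁', d₁, b₁⟩ := derivsDecay_succ.1 h₁
    obtain ⟨a₂, G₂', d₂, b₂⟩ := derivsDecay_succ.1 h₂
    exact derivsDecay_succ.2 ⟨h0 a₁ a₂, _, fun j t => (d₁ j t).add (d₂ j t), ih b₁ b₂⟩

theorem DerivsDecay.const_mul {k : ℕ} {G : ℕ → ℝ → ℝ} (h : DerivsDecay k G) (r : ℝ) :
    DerivsDecay k (fun j t => r * G j t) := by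
  have h0 {G : ℕ → ℝ → ℝ} (h : DerivsDecay 0 G) : DerivsDecay 0 (fun j t => r * G j t) := by
    obtain ⟨C, K, hC, h⟩ := derivsDecay_zero.1 h
    refine derivsDecay_zero.2 ⟨|r| * C, K, by positivity, fun j hj t ht => ?_⟩
    rw [abs_mul, mul_div_assoc, mul_assoc]
    exact mul_le_mul_of_nonneg_left (h j hj t ht) (abs_nonneg r)
  induction k generalizing G with
  | zero => exact h0 h
  | succ k ih =>
    obtain ⟨a, G', d, b⟩ := derivsDecay_succ.1 h
    exact derivsDecay_succ.2 ⟨h0 a, _, fun j t => (d j t).const_mul r, ih b⟩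

theorem DerivsDecay.exists_iteratedDeriv_le {k : ℕ} {G : ℕ → ℝ → ℝ} (h : DerivsDecay k G) :
    ∃ (C : ℝ) (K : ℕ), 0 ≤ C ∧ ∀ i, i ≤ k → ∀ j, 1 ≤ j → ∀ t, 0 ≤ t →
      |iteratedDeriv i (G j) t| ≤ C / j * (1 + t) ^ K := by
  induction k generalizing G with
  | zero =>
    obtain ⟨C, K, hC, h⟩ := derivsDecay_zero.1 h
    refine ⟨C, K, hC, fun i hi j hj t ht => ?_⟩
    rw [Nat.le_zero.1 hi, iteratedDeriv_zero]
    exact h j hj t ht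
  | succ k ih =>
    obtain ⟨a, G', d, b⟩ := derivsDecay_succ.1 h
    obtain ⟨C₁, K₁, hC₁, h₁⟩ := derivsDecay_zero.1 a
    obtain ⟨C₂, K₂, hC₂, h₂⟩ := ih b
    refine ⟨C₁ + C₂, max K₁ K₂, add_nonneg hC₁ hC₂, fun i hi j hj t ht => ?_⟩
    have e₁ : (1 + t) ^ K₁ ≤ (1 + t) ^ max K₁ K₂ :=
      pow_le_pow_right₀ (by linarith) (le_max_left _ _)
    have e₂ : (1 + t) ^ K₂ ≤ (1 + t) ^ max K₁ K₂ :=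
      pow_le_pow_right₀ (by linarith) (le_max_right _ _)
    rcases i with _ | i
    · rw [iteratedDeriv_zero]
      refine (h₁ j hj t ht).trans ?_
      gcongr
      linarith
    · rw [iteratedDeriv_succ', show deriv (G j) = G' j from funext fun t => (d j t).deriv]
      refine (h₂ i (by omega) j hj t ht).trans ?_
      gcongr
      linarith

/-! ### The multipliers and their derivatives. -/

/-- The monomials in whose span the derivatives of `(t - 1) ^ a * t ^ c * powSech j t ^ p` lie. -/
noncomputable def powMonomial (e a c p d j : ℕ) (t : ℝ) : ℝ :=
  (j : ℝ) ^ e * (t - 1) ^ a * t ^ c * powSech j t ^ p * powTanh j t ^ d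

/-- Pairing `a` factors `j * |t - 1|` with `a ≤ p` factors `powSech` gives at most `1`; since `a`
exceeds `e`, at least one `1 / j` is left over. -/
theorem derivsDecay_zero_powMonomial {e a c p d : ℕ} (hae : e + 1 ≤ a) (hap : a ≤ p) :
    DerivsDecay 0 (powMonomial e a c p d) := by
  refine derivsDecay_zero.2 ⟨1, c, zero_le_one, fun j hj t ht => ?_⟩
  have hj' : (1 : ℝ) ≤ j := by exact_mod_cast hj
  have hj0 : (0 : ℝ) < j := by linarith
  have hs := powSech_nonneg j ht
  have hpow : (j : ℝ) ^ (e + 1) ≤ (j : ℝ) ^ a := pow_le_pow_right₀ hj' hae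
  have hp : powSech j t ^ p ≤ powSech j t ^ a := pow_le_pow_of_le_one hs (powSech_le_one j t) hap
  have hd : |powTanh j t| ^ d ≤ 1 := pow_le_one₀ (abs_nonneg _) (abs_powTanh_le_one j t)
  have ht' : t ^ c ≤ (1 + t) ^ c := pow_le_pow_left₀ ht (by linarith) c
  have hm : (j * |t - 1| * powSech j t) ^ a ≤ 1 :=
    pow_le_one₀ (by positivity) (mul_abs_sub_one_mul_powSech_le_one j ht)
  rw [powMonomial, abs_mul, abs_mul, abs_mul, abs_mul, abs_pow, abs_pow, abs_pow, abs_pow, abs_pow,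
    abs_of_nonneg ht, abs_of_nonneg hs, abs_of_pos hj0]
  calc (j : ℝ) ^ e * |t - 1| ^ a * t ^ c * powSech j t ^ p * |powTanh j t| ^ d
      ≤ (j : ℝ) ^ e * |t - 1| ^ a * t ^ c * powSech j t ^ p * 1 := by gcongr
    _ = ((j : ℝ) ^ (e + 1) * |t - 1| ^ a * powSech j t ^ p) * (1 / j * t ^ c) := by
        field_simp
        ring
    _ ≤ ((j : ℝ) ^ a * |t - 1| ^ a * powSech j t ^ a) * (1 / j * (1 + t) ^ c) := by gcongr
    _ = (j * |t - 1| * powSech j t) ^ a * (1 / j * (1 + t) ^ c) := by rw [mul_pow, mul_pow]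
    _ ≤ 1 * (1 / j * (1 + t) ^ c) := by gcongr
    _ = _ := one_mul _

theorem hasDerivAt_powMonomial (e a c p d j : ℕ) (t : ℝ) :
    HasDerivAt (powMonomial e (a + 1) (c + 1) p d j)
      ((a + 1) * powMonomial e a (c + 1) p d j t + ((c + 1) * powMonomial e (a + 1) c p d j t +
        (p * powMonomial (e + 1) (a + 1) c p (d + 1) j t +
          -4 * d * powMonomial (e + 1) (a + 1) c (p + 2) (d - 1) j t))) t := by
  obtain ⟨D, hD, hD'⟩ := exists_hasDerivAt_powSech_pow j p t
  obtain ⟨E, hE, hE'⟩ := exists_hasDerivAt_powTanh_pow j d t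
  have h := (((((hasDerivAt_id t).sub_const 1).pow (a + 1)).const_mul ((j : ℝ) ^ e)).mul
    (hasDerivAt_pow (c + 1) t)).mul hD |>.mul hE
  refine h.congr_deriv ?_
  simp only [powMonomial, Nat.add_sub_cancel, id, Pi.mul_apply, Pi.pow_apply]
  push_cast
  linear_combination (j : ℝ) ^ e * (t - 1) ^ (a + 1) * t ^ c * powTanh j t ^ d * hD' +
    (j : ℝ) ^ e * (t - 1) ^ (a + 1) * t ^ c * powSech j t ^ p * hE'

/-- Each derivative lowers `a - e` by at most one, uses at most one power of `t`, and preserves `a ≤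
p`. -/
theorem derivsDecay_powMonomial {k e a c p d : ℕ} (hae : e + k + 1 ≤ a) (hap : a ≤ p) (hc : k ≤ c) :
    DerivsDecay k (powMonomial e a c p d) := by
  induction k generalizing e a c p d with
  | zero => exact derivsDecay_zero_powMonomial hae hap
  | succ k ih =>
    refine derivsDecay_succ.2 ⟨derivsDecay_zero_powMonomial (by omega) hap, ?_⟩
    obtain ⟨a, rfl⟩ : ∃ a', a = a' + 1 := ⟨a - 1, by omega⟩
    obtain ⟨c, rfl⟩ : ∃ c', c = c' + 1 := ⟨c - 1, by omega⟩
    refine ⟨_, hasDerivAt_powMonomial e a c p d, ?_⟩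
    refine .add (.const_mul (ih ?_ ?_ ?_) _) (.add (.const_mul (ih ?_ ?_ ?_) _)
      (.add (.const_mul (ih ?_ ?_ ?_) _) (.const_mul (ih ?_ ?_ ?_) _))) <;> omega

theorem contDiff_powMonomial (e a c p d j : ℕ) {n : WithTop ℕ∞} :
    ContDiff ℝ n (powMonomial e a c p d j) := by
  unfold powMonomial powSech powTanh
  have (t : ℝ) : 1 + t ^ (2 * j) ≠ 0 := (one_add_pow_two_mul_pos j t).ne'
  fun_prop (disch := assumption)

theorem hasTemperateGrowth_powSech (j : ℕ) : (powSech j).HasTemperateGrowth := by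
  have h1 : (fun t : ℝ => t ^ j).HasTemperateGrowth := by fun_prop
  have h2 := (Function.hasTemperateGrowth_one_add_norm_sq_rpow ℝ (-1)).comp h1
  have h : powSech j =
      (fun t : ℝ => t ^ j) * ((fun x : ℝ => (1 + ‖x‖ ^ 2) ^ (-1 : ℝ)) ∘ fun t : ℝ => t ^ j) := by
    funext t
    simp [powSech, div_eq_mul_inv, Real.rpow_neg_one, ← pow_mul, mul_comm 2 j]
  rw [h]
  exact h1.mul h2

theorem hasTemperateGrowth_powMonomial (a c p j : ℕ) :
    (powMonomial 0 a c p 0 j).HasTemperateGrowth := by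
  have h := hasTemperateGrowth_powSech j
  have : powMonomial 0 a c p 0 j = fun t => (t - 1) ^ a * t ^ c * powSech j t ^ p := by
    funext t
    simp [powMonomial]
  rw [this]
  fun_prop

/-! ### Schwartz seminorms of `G j (b x) φ(x)`. -/

section

variable {E : Type*} [NormedAddCommGroup E] [NormedSpace ℝ E]

/-- Derivatives of `G j ∘ b` are `O(1 / j)` up to polynomial growth. -/
theorem DerivsDecay.exists_norm_iteratedFDeriv_comp_le {m : ℕ} {G : ℕ → ℝ → ℝ}
    (hG : DerivsDecay m G) (hGs : ∀ j, ContDiff ℝ m (G j)) {b : E → ℝ}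
    (hb : b.HasTemperateGrowth) (hb0 : ∀ x, 0 ≤ b x) :
    ∃ (C : ℝ) (q : ℕ), 0 ≤ C ∧ ∀ i, i ≤ m → ∀ j, 1 ≤ j → ∀ x,
      ‖iteratedFDeriv ℝ i (G j ∘ b) x‖ ≤ C / j * (1 + ‖x‖) ^ q := by
  obtain ⟨C, K, hC, hG⟩ := hG.exists_iteratedDeriv_le
  obtain ⟨k, B, hB, hbd⟩ := hb.norm_iteratedFDeriv_le_uniform m
  refine ⟨m.factorial * C * 2 ^ K * (1 + B) ^ (K + m), k * (K + m), by positivity,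
    fun i hi j hj x => ?_⟩
  -- `D` dominates `b x` and all derivatives of `b` in question; `D ≥ 1` gives `D ≤ D ^ i'`, the
  -- form required by the bound for a composition.
  set D := (1 + B) * (1 + ‖x‖) ^ k with hD
  have hx : 1 ≤ (1 + ‖x‖) ^ k := one_le_pow₀ (by linarith [norm_nonneg x])
  have hD1 : 1 ≤ D := by nlinarith
  have hBD : B * (1 + ‖x‖) ^ k ≤ D := by rw [hD]; nlinarith
  have hbx : b x ≤ D := by
    have := hbd 0 (Nat.zero_le _) x
    rw [norm_iteratedFDeriv_zero] at this
    exact (Real.le_norm_self _).trans (this.trans hBD)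
  have hj0 : (0 : ℝ) < j := by exact_mod_cast hj
  have key := norm_iteratedFDeriv_comp_le (n := i) (N := m) (C := C / j * (1 + b x) ^ K) (D := D)
    (hGs j) (hb.1.of_le (by exact_mod_cast le_top)) (by exact_mod_cast hi) x
    (fun i' hi' => by
      rw [norm_iteratedFDeriv_eq_norm_iteratedDeriv]
      exact hG i' (hi'.trans hi) j hj _ (hb0 x))
    (fun i' h1 hi' => ((hbd i' (hi'.trans hi) x).trans hBD).trans
      (le_self_pow₀ hD1 (by omega)))
  refine key.trans ?_
  have hfac : (i.factorial : ℝ) ≤ m.factorial := by exact_mod_cast Nat.factorial_le hi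
  have hb1 : 1 + b x ≤ 2 * D := by linarith
  have hDi : D ^ i ≤ D ^ m := pow_le_pow_right₀ hD1 hi
  calc (i.factorial : ℝ) * (C / j * (1 + b x) ^ K) * D ^ i
      ≤ m.factorial * (C / j * (2 * D) ^ K) * D ^ m := by
        have := hb0 x
        gcongr
    _ = m.factorial * C * 2 ^ K / j * D ^ (K + m) := by rw [mul_pow, pow_add]; ring
    _ = _ := by rw [hD, mul_pow, pow_mul]; ring

/-- Leibniz rule; the polynomial growth `(1 + ‖x‖) ^ q` is absorbed by the seminorms of `φ`. -/
theorem DerivsDecay.exists_seminorm_le {m : ℕ} {G : ℕ → ℝ → ℝ}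
    (hG : DerivsDecay m G) (hGs : ∀ j, ContDiff ℝ m (G j)) {b : E → ℝ}
    (hb : b.HasTemperateGrowth) (hb0 : ∀ x, 0 ≤ b x) (φ : 𝓢(E, ℂ)) (k : ℕ) {i : ℕ} (hi : i ≤ m) :
    ∃ C : ℝ, 0 ≤ C ∧ ∀ j, 1 ≤ j → ∀ ψ : 𝓢(E, ℂ), (∀ x, ψ x = G j (b x) • φ x) →
      SchwartzMap.seminorm ℂ k i ψ ≤ C / j := by
  obtain ⟨C, q, hC, h⟩ := hG.exists_norm_iteratedFDeriv_comp_le hGs hb hb0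
  set A := 2 ^ (q + k) *
    (Finset.Iic (q + k, m)).sup (fun n => SchwartzMap.seminorm ℂ n.1 n.2) φ with hA
  have hA0 : 0 ≤ A := by positivity
  refine ⟨2 ^ i * C * A, by positivity, fun j hj ψ hψ => ?_⟩
  have hj0 : (0 : ℝ) < j := by exact_mod_cast hj
  refine SchwartzMap.seminorm_le_bound ℂ k i ψ (by positivity) fun x => ?_
  have hψ' : (ψ : E → ℂ) = fun x => (G j ∘ b) x • φ x := funext hψ
  have hcomp : ContDiff ℝ m (G j ∘ b) := (hGs j).comp (hb.1.of_le (by exact_mod_cast le_top))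
  have hle := norm_iteratedFDeriv_smul_le hcomp (φ.smooth m) x (n := i) (by exact_mod_cast hi)
  rw [hψ']
  have hx : 0 ≤ ‖x‖ := norm_nonneg x
  calc ‖x‖ ^ k * ‖iteratedFDeriv ℝ i (fun x => (G j ∘ b) x • φ x) x‖
      ≤ (1 + ‖x‖) ^ k * ∑ n ∈ Finset.range (i + 1), (i.choose n : ℝ) *
          ‖iteratedFDeriv ℝ n (G j ∘ b) x‖ * ‖iteratedFDeriv ℝ (i - n) φ x‖ := by
        gcongr
        linarith
    _ = ∑ n ∈ Finset.range (i + 1), (1 + ‖x‖) ^ k * ((i.choose n : ℝ) *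
          ‖iteratedFDeriv ℝ n (G j ∘ b) x‖ * ‖iteratedFDeriv ℝ (i - n) φ x‖) :=
        Finset.mul_sum _ _ _
    _ ≤ ∑ n ∈ Finset.range (i + 1), (i.choose n : ℝ) * (C / j * A) := by
        refine Finset.sum_le_sum fun n hn => ?_
        have hn' : n ≤ m := by have := Finset.mem_range.1 hn; omega
        have h2 := SchwartzMap.one_add_le_sup_seminorm_apply (𝕜 := ℂ) (m := (q + k, m))
          (k := q + k) (n := i - n) le_rfl (by simp only; omega) φ x
        calc (1 + ‖x‖) ^ k * ((i.choose n : ℝ) *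
              ‖iteratedFDeriv ℝ n (G j ∘ b) x‖ * ‖iteratedFDeriv ℝ (i - n) φ x‖)
            ≤ (1 + ‖x‖) ^ k * ((i.choose n : ℝ) *
              (C / j * (1 + ‖x‖) ^ q) * ‖iteratedFDeriv ℝ (i - n) φ x‖) := by
              gcongr
              exact h n hn' j hj x
          _ = (i.choose n : ℝ) *
              (C / j * ((1 + ‖x‖) ^ (q + k) * ‖iteratedFDeriv ℝ (i - n) φ x‖)) := by
              rw [pow_add]; ring
          _ ≤ _ := by gcongr
    _ = 2 ^ i * C * A / j := by
        rw [← Finset.sum_mul]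
        have := Nat.sum_range_choose i
        have h2 : ∑ n ∈ Finset.range (i + 1), (i.choose n : ℝ) = 2 ^ i := by exact_mod_cast this
        rw [h2]
        ring

/-- For every continuous seminorm `ν` the functions `G j (b x) φ(x)` are `O(1 / j)`, provided that
sufficiently many derivatives of the `G j` are. -/
theorem exists_forall_derivsDecay_seminorm_le (ν : Seminorm ℂ 𝓢(E, ℂ)) (hν : Continuous ν)
    {b : E → ℝ} (hb : b.HasTemperateGrowth) (hb0 : ∀ x, 0 ≤ b x) :
    ∃ m : ℕ, ∀ G : ℕ → ℝ → ℝ, DerivsDecay m G → (∀ j, ContDiff ℝ m (G j)) → ∀ φ : 𝓢(E, ℂ),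
      ∃ C : ℝ, 0 ≤ C ∧ ∀ j, 1 ≤ j → ∀ ψ : 𝓢(E, ℂ), (∀ x, ψ x = G j (b x) • φ x) → ν ψ ≤ C / j := by
  obtain ⟨s, R, -, hR⟩ := Seminorm.bound_of_continuous (schwartz_withSeminorms ℂ E ℂ) ν hν
  -- The highest order of derivative in the seminorms controlling `ν`; it is fixed before `G`, so
  -- `G` may be built from it.
  refine ⟨s.sup Prod.snd, fun G hG hGs φ => ?_⟩
  have hex (n : ℕ × ℕ) (hn : n ∈ s) := hG.exists_seminorm_le hGs hb hb0 φ n.1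
    (Finset.le_sup (f := Prod.snd) hn)
  choose! C hC0 hC using hex
  refine ⟨R * ∑ n ∈ s, C n, mul_nonneg R.2 (Finset.sum_nonneg hC0), fun j hj ψ hψ => ?_⟩
  refine (hR ψ).trans ?_
  rw [smul_apply, NNReal.smul_def, smul_eq_mul, mul_div_assoc]
  refine mul_le_mul_of_nonneg_left ?_ R.2
  have hsum : 0 ≤ ∑ n ∈ s, C n := Finset.sum_nonneg hC0
  refine Seminorm.finset_sup_apply_le (by positivity) fun n hn => ?_
  refine (hC n hn j hj ψ hψ).trans ?_
  gcongr
  exact Finset.single_le_sum (f := C) hC0 hn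

open Polynomial in
theorem SchwartzMap.aeval_smulLeftCLM_apply {b : E → ℝ} (hb : b.HasTemperateGrowth) (P : ℝ[X])
    (φ : 𝓢(E, ℂ)) (x : E) :
    (aeval (R := ℝ) (A := Module.End ℝ 𝓢(E, ℂ)) (smulLeftCLM ℂ b : 𝓢(E, ℂ) →ₗ[ℝ] 𝓢(E, ℂ)) P φ) x =
      P.eval (b x) • φ x := by
  induction P using Polynomial.induction_on generalizing φ with
  | C a => simp [Algebra.algebraMap_eq_smul_one]
  | add P Q hP hQ => simp [hP, hQ, add_mul]
  | monomial n a h =>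
    rw [pow_succ, ← mul_assoc, map_mul, Module.End.mul_apply, h, aeval_X,
      ContinuousLinearMap.coe_coe, smulLeftCLM_apply_apply hb, eval_mul (q := X), eval_X, mul_smul]

end

/-! ### Bounded two-sided sequences shifted by an operator. -/

section

variable {V : Type*} [AddCommGroup V] [Module ℝ V] {B : Module.End ℝ V} {S : ℤ → V →ₗ[ℝ] ℂ}

theorem apply_pow_eq_of_shift (hS : ∀ k φ, S k (B φ) = S (k + 1) φ) (k : ℤ) (n : ℕ) (φ : V) :
    S k ((B ^ n) φ) = S (k + n) φ := by
  induction n generalizing k with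
  | zero => simp
  | succ n ih =>
    rw [pow_succ', Module.End.mul_apply, hS, ih]
    congr 2
    push_cast
    ring

open Polynomial in
theorem norm_apply_aeval_one_add_pow_le (hS : ∀ k φ, S k (B φ) = S (k + 1) φ) {φ : V} {R : ℝ}
    (hR : ∀ k, ‖S k φ‖ ≤ R) (n p : ℕ) (k : ℤ) :
    ‖S k (aeval B ((1 + X ^ n : ℝ[X]) ^ p) φ)‖ ≤ 2 ^ p * R := by
  induction p generalizing k with
  | zero => simpa using hR k
  | succ p ih =>
    rw [pow_succ', map_mul, Module.End.mul_apply, map_add, map_one, map_pow, aeval_X,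
      LinearMap.add_apply, Module.End.one_apply, map_add, apply_pow_eq_of_shift hS]
    refine (norm_add_le _ _).trans ((add_le_add (ih k) (ih (k + n))).trans_eq ?_)
    ring

/-- A bounded sequence `S k` with `S k ∘ B = S (k + 1)` that is annihilated by some power
of `B - 1` is constant. -/
theorem apply_sub_one_eq_zero_of_bounded (hS : ∀ k φ, S k (B φ) = S (k + 1) φ)
    (hR : ∀ φ, ∃ R, ∀ k, ‖S k φ‖ ≤ R) {n : ℕ} (hn : ∀ k φ, S k (((B - 1) ^ (n + 1)) φ) = 0)
    (k : ℤ) (φ : V) : S k ((B - 1) φ) = 0 := by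
  induction n generalizing k φ with
  | zero => simpa using hn k φ
  | succ n ih =>
    refine ih (fun k φ => ?_) k φ
    set ψ := ((B - 1) ^ n) φ with hψ
    have e1 (k : ℤ) (χ : V) : S k ((B - 1) χ) = S (k + 1) χ - S k χ := by
      rw [LinearMap.sub_apply, Module.End.one_apply, map_sub, hS]
    have e2 (k : ℤ) : S (k + 1) ((B - 1) ψ) = S k ((B - 1) ψ) := by
      have := hn k φ
      rwa [pow_succ', pow_succ', Module.End.mul_apply, Module.End.mul_apply, ← hψ, e1 k,
        sub_eq_zero] at this
    rw [pow_succ', Module.End.mul_apply, ← hψ]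
    set v := S k ((B - 1) ψ) with hv
    -- Since `(B - 1) ^ 2 ψ` is annihilated, `S (k + N) ψ` is an arithmetic progression with
    -- difference `v`; boundedness forces `v = 0`.
    have e3 (N : ℕ) : S (k + N) ((B - 1) ψ) = v ∧ S (k + N) ψ = S k ψ + N * v := by
      induction N with
      | zero => simp [hv]
      | succ N ihN =>
        have hk : k + ((N + 1 : ℕ) : ℤ) = k + N + 1 := by push_cast; ring
        rw [hk, e2]
        refine ⟨ihN.1, ?_⟩
        have := e1 (k + N) ψ
        rw [ihN.1, ihN.2] at this
        push_cast
        linear_combination -this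
    obtain ⟨R, hR⟩ := hR ψ
    by_contra hv0
    have hpos : 0 < ‖v‖ := norm_pos_iff.2 hv0
    obtain ⟨N, hN⟩ := exists_nat_gt (2 * R / ‖v‖)
    rw [div_lt_iff₀ hpos] at hN
    have h1 : (N : ℂ) * v = S (k + N) ψ - S k ψ := by rw [(e3 N).2]; ring
    have h2 : N * ‖v‖ ≤ R + R := by
      calc N * ‖v‖ = ‖(N : ℂ) * v‖ := by simp
        _ ≤ ‖S (k + N) ψ‖ + ‖S k ψ‖ := by rw [h1]; exact norm_sub_le _ _
        _ ≤ R + R := add_le_add (hR _) (hR _)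
    linarith

end

/-! ### Constancy of bounded sequences generated by a nonnegative multiplier. -/

open Polynomial in
/-- A uniformly bounded two-sided sequence of tempered distributions, each of which is `b` times its
predecessor, where `b ≥ 0`, is constant. -/
theorem SchwartzMap.eq_of_bounded_of_smulLeftCLM_shift {E : Type*} [NormedAddCommGroup E]
    [NormedSpace ℝ E] {b : E → ℝ} (hb : b.HasTemperateGrowth) (hb0 : ∀ x, 0 ≤ b x)
    {S : ℤ → 𝓢(E, ℂ) →ₗ[ℝ] ℂ} (hS : ∀ k φ, S k (smulLeftCLM ℂ b φ) = S (k + 1) φ)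
    (ν : Seminorm ℂ 𝓢(E, ℂ)) (hν : Continuous ν) (hSν : ∀ k φ, ‖S k φ‖ ≤ ν φ) (k : ℤ)
    (φ : 𝓢(E, ℂ)) : S (k + 1) φ = S k φ := by
  let B : Module.End ℝ 𝓢(E, ℂ) := (smulLeftCLM ℂ b : 𝓢(E, ℂ) →ₗ[ℝ] 𝓢(E, ℂ))
  have hS' : ∀ k φ, S k (B φ) = S (k + 1) φ := hS
  obtain ⟨m, hm⟩ := exists_forall_derivsDecay_seminorm_le ν hν hb hb0
  have hzero (k : ℤ) (φ : 𝓢(E, ℂ)) : S k (((B - 1) ^ (m + 1)) φ) = 0 := by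
    -- The exponents are the least that `derivsDecay_powMonomial` allows for `m` derivatives with `e
    -- = 0`.
    obtain ⟨C, hC, hj⟩ := hm (powMonomial 0 (m + 1) m (m + 1) 0)
      (derivsDecay_powMonomial (by omega) le_rfl le_rfl)
      (fun j => contDiff_powMonomial _ _ _ _ _ _) φ
    have hbound (j : ℕ) (h1 : 1 ≤ j) :
        ‖S k (((B - 1) ^ (m + 1)) φ)‖ ≤ 2 ^ (m + 1) * C / j := by
      have hg : (fun x => powMonomial 0 (m + 1) m (m + 1) 0 j (b x)).HasTemperateGrowth :=
        (hasTemperateGrowth_powMonomial _ _ _ _).comp hb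
      set ψ := smulLeftCLM ℂ (fun x => powMonomial 0 (m + 1) m (m + 1) 0 j (b x)) φ with hψ
      have hψx (x : E) : ψ x = powMonomial 0 (m + 1) m (m + 1) 0 j (b x) • φ x :=
        smulLeftCLM_apply_apply hg φ x
      -- The factor `(1 + b ^ (2 * j)) ^ (m + 1)` clears the denominator of `powSech ^ (m + 1)`;
      -- both sides are compared as multipliers of `φ`.
      have hid : aeval B ((1 + X ^ (2 * j) : ℝ[X]) ^ (m + 1)) ψ =
          (B ^ (j * (m + 1) + m)) (((B - 1) ^ (m + 1)) φ) := by
        have : (B ^ (j * (m + 1) + m)) (((B - 1) ^ (m + 1)) φ) =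
            aeval B (X ^ (j * (m + 1) + m) * (X - 1) ^ (m + 1) : ℝ[X]) φ := by
          simp
        rw [this]
        ext x
        rw [aeval_smulLeftCLM_apply hb, aeval_smulLeftCLM_apply hb, hψx, smul_smul]
        congr 1
        have h0 := (one_add_pow_two_mul_pos j (b x)).ne'
        simp only [eval_pow, eval_add, eval_one, eval_X, eval_mul, eval_sub, powMonomial, powSech,
          div_pow]
        field_simp
        ring
      -- Starting this far back in the two-sided sequence compensates the power of `B` in `hid`, so
      -- the index returns to `k`.
      have h2 := norm_apply_aeval_one_add_pow_le hS' (hSν · ψ) (2 * j) (m + 1)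
        (k - (j * (m + 1) + m : ℕ))
      rw [hid, apply_pow_eq_of_shift hS', sub_add_cancel] at h2
      rw [mul_div_assoc]
      exact h2.trans (by gcongr; exact hj j h1 ψ hψx)
    have hlim : Filter.Tendsto (fun j : ℕ => 2 ^ (m + 1) * C / j) Filter.atTop (nhds 0) :=
      tendsto_const_div_atTop_nhds_zero_nat _
    exact norm_le_zero_iff.1 (ge_of_tendsto hlim
      (Filter.eventually_atTop.2 ⟨1, fun j h1 => hbound j h1⟩))
  have := apply_sub_one_eq_zero_of_bounded hS' (fun φ => ⟨ν φ, fun k => hSν k φ⟩) hzero k φ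
  rwa [LinearMap.sub_apply, Module.End.one_apply, map_sub, hS', sub_eq_zero] at this

/-! ### Averaging over the group, and passage to the Fourier side. -/

namespace TemperedInvariance

variable {l : ℕ}

theorem act_apply (w : EuclideanSpace ℝ (Fin l) ≃ₗᵢ[ℝ] EuclideanSpace ℝ (Fin l))
    (f : 𝓢(EuclideanSpace ℝ (Fin l), ℂ)) (x : EuclideanSpace ℝ (Fin l)) :
    act w f x = f (w x) := rfl

/-- The average of a Schwartz function over a finite group of isometries is invariant. -/
theorem isInvariantFun_average
    (W : Subgroup (EuclideanSpace ℝ (Fin l) ≃ₗᵢ[ℝ] EuclideanSpace ℝ (Fin l))) [Fintype W]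
    (f : 𝓢(EuclideanSpace ℝ (Fin l), ℂ)) :
    IsInvariantFun W (((Fintype.card W : ℂ)⁻¹ • ∑ w : W, act w.1) f) := by
  intro w hw x
  simp only [smul_apply, sum_apply, act_apply]
  congr 1
  exact Fintype.sum_equiv (Equiv.mulRight (⟨w, hw⟩ : W)) _ _ fun v => rfl

theorem IsInvariantDist.apply_average
    {W : Subgroup (EuclideanSpace ℝ (Fin l) ≃ₗᵢ[ℝ] EuclideanSpace ℝ (Fin l))} [Fintype W]
    {T : 𝓢'(EuclideanSpace ℝ (Fin l), ℂ)} (hT : IsInvariantDist W T)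
    (f : 𝓢(EuclideanSpace ℝ (Fin l), ℂ)) :
    T (((Fintype.card W : ℂ)⁻¹ • ∑ w : W, act w.1) f) = T f := by
  have hcard : (Fintype.card W : ℂ) ≠ 0 := by exact_mod_cast Fintype.card_ne_zero
  simp only [smul_apply, sum_apply, map_smul, map_sum, hT _ (Subtype.property _)]
  rw [Finset.sum_const, Finset.card_univ, nsmul_eq_mul, smul_eq_mul, inv_mul_cancel_left₀ hcard]

/-- Invariant distributions that are uniformly bounded on invariant Schwartz functions are uniformly
bounded on all Schwartz functions. -/
theorem exists_seminorm_of_isInvariantDist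
    {W : Subgroup (EuclideanSpace ℝ (Fin l) ≃ₗᵢ[ℝ] EuclideanSpace ℝ (Fin l))} [Finite W]
    {T : ℤ → 𝓢'(EuclideanSpace ℝ (Fin l), ℂ)} (hT : ∀ j, IsInvariantDist W (T j))
    (μ : Seminorm ℂ 𝓢(EuclideanSpace ℝ (Fin l), ℂ)) (hμ : Continuous μ) {M : ℝ} (hM : 0 < M)
    (hbound : ∀ j ψ, IsInvariantFun W ψ → ‖T j ψ‖ ≤ M * μ ψ) :
    ∃ ν : Seminorm ℂ 𝓢(EuclideanSpace ℝ (Fin l), ℂ), Continuous ν ∧ ∀ j ψ, ‖T j ψ‖ ≤ ν ψ := by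
  have := Fintype.ofFinite W
  let A : 𝓢(EuclideanSpace ℝ (Fin l), ℂ) →L[ℂ] 𝓢(EuclideanSpace ℝ (Fin l), ℂ) :=
    (Fintype.card W : ℂ)⁻¹ • ∑ w : W, act w.1
  refine ⟨M.toNNReal • μ.comp A.toLinearMap, ?_, fun j ψ => ?_⟩
  · exact continuous_const.mul (hμ.comp A.continuous)
  · rw [← (hT j).apply_average ψ]
    refine (hbound j _ (isInvariantFun_average W ψ)).trans_eq ?_
    exact congrArg (· * μ (A ψ)) (Real.coe_toNNReal M hM.le).symm

/-- The inverse Fourier transform turns multiplication by `-(4π²|x|² + |ρ|²)` into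
`L - |ρ|²`. -/
theorem shiftedLaplacian_apply_fourierInv (ρ : EuclideanSpace ℝ (Fin l))
    (T : 𝓢'(EuclideanSpace ℝ (Fin l), ℂ)) (φ : 𝓢(EuclideanSpace ℝ (Fin l), ℂ)) :
    shiftedLaplacian ρ T (FourierTransformInv.fourierInv φ) =
      -T (FourierTransformInv.fourierInv (SchwartzMap.smulLeftCLM ℂ
        (fun x : EuclideanSpace ℝ (Fin l) => (2 * Real.pi) ^ 2 * ‖x‖ ^ 2 + ‖ρ‖ ^ 2) φ)) := by
  have h : SchwartzMap.smulLeftCLM ℂ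
      (fun x : EuclideanSpace ℝ (Fin l) => (2 * Real.pi) ^ 2 * ‖x‖ ^ 2 + ‖ρ‖ ^ 2) φ =
      (((2 * Real.pi) ^ 2 : ℝ) : ℂ) •
        SchwartzMap.smulLeftCLM ℂ (fun x : EuclideanSpace ℝ (Fin l) => ‖x‖ ^ 2) φ +
      ((‖ρ‖ ^ 2 : ℝ) : ℂ) • φ := by
    ext x
    simp only [add_apply, smul_apply]
    rw [SchwartzMap.smulLeftCLM_apply_apply (by fun_prop),
      SchwartzMap.smulLeftCLM_apply_apply (by fun_prop)]
    simp only [Complex.real_smul, smul_eq_mul]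
    push_cast
    ring
  have hΔ : Δ (FourierTransformInv.fourierInv φ) = -((((2 * Real.pi) ^ 2 : ℝ) : ℂ) •
      FourierTransformInv.fourierInv
        (SchwartzMap.smulLeftCLM ℂ (fun x : EuclideanSpace ℝ (Fin l) => ‖x‖ ^ 2) φ)) := by
    rw [SchwartzMap.laplacian_eq_fourierMultiplierCLM, SchwartzMap.fourierMultiplierCLM_apply,
      FourierTransform.fourier_fourierInv_eq, neg_smul]
    rfl
  rw [h, FourierTransform.fourierInv_add, FourierTransform.fourierInv_smul,
    FourierTransform.fourierInv_smul, map_add, map_smul, map_smul]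
  change (Δ T) (FourierTransformInv.fourierInv φ) -
    ((‖ρ‖ ^ 2 : ℝ) : ℂ) • T (FourierTransformInv.fourierInv φ) = _
  rw [TemperedDistribution.laplacian_apply_apply, hΔ, map_neg, map_smul]
  ring

/-- The characterisation of eigendistributions of `L - |ρ|²` by bounded two-sided sequences, without
invariance. -/
theorem shiftedLaplacian_eq_of_bounded (ρ : EuclideanSpace ℝ (Fin l))
    {T : ℤ → 𝓢'(EuclideanSpace ℝ (Fin l), ℂ)} {z : ℂ} (hz : z ≠ 0)
    (hrec : ∀ j, shiftedLaplacian ρ (T j) = z • T (j + 1))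
    (ν : Seminorm ℂ 𝓢(EuclideanSpace ℝ (Fin l), ℂ)) (hν : Continuous ν)
    (hbound : ∀ j ψ, ‖T j ψ‖ ≤ ν ψ) :
    shiftedLaplacian ρ (T 0) = -((‖z‖ : ℂ) • T 0) := by
  have hz0 : 0 < ‖z‖ := norm_pos_iff.2 hz
  have hzC : (‖z‖ : ℂ) ≠ 0 := by exact_mod_cast hz0.ne'
  -- The twist by `u ^ k` removes the phase of `-z`, leaving a nonnegative multiplier, and keeps the
  -- bounds because `‖u‖ = 1`.
  set u : ℂ := -z / ‖z‖ with hu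
  have hu1 : ‖u‖ = 1 := by simp [hu, hz0.ne']
  have hu0 : u ≠ 0 := norm_pos_iff.1 (by rw [hu1]; exact one_pos)
  let F := FourierTransform.fourierInvCLM ℂ 𝓢(EuclideanSpace ℝ (Fin l), ℂ)
  let S : ℤ → 𝓢(EuclideanSpace ℝ (Fin l), ℂ) →ₗ[ℝ] ℂ := fun k =>
    (u ^ k • ((T k : 𝓢(EuclideanSpace ℝ (Fin l), ℂ) →ₗ[ℂ] ℂ) ∘ₗ F.toLinearMap)).restrictScalars ℝ
  have hSa (k φ) : S k φ = u ^ k * T k (FourierTransformInv.fourierInv φ) := rfl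
  let a : EuclideanSpace ℝ (Fin l) → ℝ := fun x => (2 * Real.pi) ^ 2 * ‖x‖ ^ 2 + ‖ρ‖ ^ 2
  have ha : a.HasTemperateGrowth := by fun_prop
  have hb : (‖z‖⁻¹ • a).HasTemperateGrowth := by
    have : (fun x => ‖z‖⁻¹ * a x).HasTemperateGrowth := by fun_prop
    exact this
  have hrec' (k φ) : T k (FourierTransformInv.fourierInv (SchwartzMap.smulLeftCLM ℂ a φ)) =
      -(z * T (k + 1) (FourierTransformInv.fourierInv φ)) := by
    have h := shiftedLaplacian_apply_fourierInv ρ (T k) φ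
    rw [hrec] at h
    exact neg_eq_iff_eq_neg.1 h.symm
  have hS : ∀ k φ, S k (SchwartzMap.smulLeftCLM ℂ (‖z‖⁻¹ • a) φ) = S (k + 1) φ := by
    intro k φ
    rw [SchwartzMap.smulLeftCLM_smul ha, smul_apply, map_smul, hSa, hSa, hrec', zpow_add_one₀ hu0,
      hu, Complex.real_smul]
    push_cast
    field_simp
  have key := SchwartzMap.eq_of_bounded_of_smulLeftCLM_shift hb
    (fun x => mul_nonneg (inv_nonneg.2 hz0.le) (by positivity)) hS (ν.comp F.toLinearMap)
    (hν.comp F.continuous) (fun k φ => by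
      rw [hSa, norm_mul, norm_zpow, hu1, one_zpow, one_mul]
      exact hbound k _) 0
  rw [hrec]
  ext φ
  -- This is `u • T 1 = T 0`; as `z / u = -‖z‖`, it gives `z • T 1 = -‖z‖ • T 0`.
  have h := key (FourierTransform.fourier φ)
  rw [hSa, hSa, FourierTransform.fourierInv_fourier_eq, zero_add, zpow_zero, zpow_one, hu] at h
  change z * T (0 + 1) φ = -((‖z‖ : ℂ) * T 0 φ)
  rw [zero_add]
  field_simp at h
  linear_combination -h

end TemperedInvariance

theorem theorem3p1 {𝔤 : Type*} [LieRing 𝔤] [LieAlgebra ℝ 𝔤] [FiniteDimensional ℝ 𝔤]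
    [LieAlgebra.IsSemisimple ℝ 𝔤]
    (θ : 𝔤 ≃ₗ⁅ℝ⁆ 𝔤) (hθ : SymmetricSpaceData.IsCartanInvolution θ)
    (𝔞 : Submodule ℝ 𝔤) (h𝔞 : SymmetricSpaceData.IsMaximalAbelianIn θ 𝔞)
    (H₀ : 𝔞) (hH₀ : SymmetricSpaceData.IsRegular 𝔞 H₀)
    {l : ℕ} (e : EuclideanSpace ℝ (Fin l) ≃ₗ[ℝ] 𝔞)
    (he : SymmetricSpaceData.IsKillingIsometry e)
    (T : ℤ → 𝓢'(EuclideanSpace ℝ (Fin l), ℂ))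
    (hT : ∀ j, TemperedInvariance.IsInvariantDist (SymmetricSpaceData.weylGroup θ e) (T j))
    (z : ℂ) (hz : ‖SymmetricSpaceData.rhoVec e H₀‖ ^ 2 ≤ ‖z‖)
    (hrec : ∀ j, TemperedInvariance.shiftedLaplacian (SymmetricSpaceData.rhoVec e H₀) (T j) =
      z • T (j + 1))
    (μ : Seminorm ℂ 𝓢(EuclideanSpace ℝ (Fin l), ℂ)) (hμ : Continuous μ)
    (M : ℝ) (hM : 0 < M)
    (hbound : ∀ j, ∀ ψ : 𝓢(EuclideanSpace ℝ (Fin l), ℂ),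
      TemperedInvariance.IsInvariantFun (SymmetricSpaceData.weylGroup θ e) ψ →
        ‖T j ψ‖ ≤ M * μ ψ) :
    TemperedInvariance.shiftedLaplacian (SymmetricSpaceData.rhoVec e H₀) (T 0) =
      -((‖z‖ : ℂ) • T 0) := by
  have := SymmetricSpaceData.finite_weylGroup hθ h𝔞 he
  obtain ⟨ν, hν, hTν⟩ := TemperedInvariance.exists_seminorm_of_isInvariantDist hT μ hμ hM hbound
  -- For `z = 0` the recurrence already says that both sides vanish.
  by_cases hz0 : z = 0
  · rw [hrec, hz0, norm_zero, Complex.ofReal_zero]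
    ext φ
    change 0 * T (0 + 1) φ = -(0 * T 0 φ)
    ring
  · exact TemperedInvariance.shiftedLaplacian_eq_of_bounded _ hz0 hrec ν hν hTν
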